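/- Let $\overline{\mathbb R}_+=[0,\infty]$ and $\mathbb R_+=[0,\infty)$, both with the Scott topology, whose open sets are the empty set, the whole space and the sets of all elements $>r$, $r\in\mathbb R_+$. Continuous maps to $\overline{\mathbb R}_+$ are called lower semi-continuous. A continuous valuation on a space $X$ is a map $\nu$ from the open subsets of $X$ to $\overline{\mathbb R}_+$ with $\nu(\emptyset)=0$, monotone, modular ($\nu(U)+\nu(V)=\nu(U\cup V)+\nu(U\cap V)$) and such that $\nu(\bigcup_i U_i)=\sup_i\nu(U_i)$ for directed families. $\mathcal V_wX$ is the set of continuous valuations on $X$ with the weak topology, generated by the sets $\{\nu\mid \nu(U)>r\}$, $U$ open in $X$, $r\in\mathbb R_+$. For $h\colon X\to\overline{\mathbb R}_+$ lower semi-continuous, put $\int h\,d\nu=\int_0^\infty\nu(h^{-1}(r,\infty])\,dr$. A $\mathcal V_w$-algebra is a $T_0$ space $A$ with a continuous map $\alpha\colon\mathcal V_wA\to A$, its structure map, such that $\alpha(\delta_x)=x$ for all $x\in A$, where $\delta_x$ is the Dirac mass at $x$, and $\alpha(m(\varpi))=\alpha(\mathcal V_w\alpha(\varpi))$ for all $\varpi\in\mathcal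 V_w\mathcal V_wA$, where $m(\varpi)(U)=\int_{\mu\in\mathcal V_wA}\mu(U)\,d\varpi$ and $\mathcal V_w\alpha(\varpi)(U)=\varpi(\alpha^{-1}(U))$. A cone is a commutative monoid with a scalar multiplication by $\mathbb R_+$ satisfying the vector space axioms, including $0\cdot x=0$ and $r\cdot 0=0$. It is a semitopological (resp. topological) cone if it carries a $T_0$ topology for which addition and scalar multiplication $\mathbb R_+\times C\to C$ are separately (resp. jointly) continuous. A half-space is a convex subset whose complement is convex; $C$ is locally linear if it has a subbase of open half-spaces. A barycentre of a continuous valuation $\nu$ on a semitopological cone $C$ is a point $b\in C$ with $\Lambda(b)=\int\Lambda\,d\nu$ for every linear lower semi-continuous map $\Lambda\colon C\to\overline{\mathbb R}_+$. **Proposition.** Let $C$ be a locally linear semitopological cone such that every continuous valuation on $C$ has a barycentre. Then every continuous valuation $\nu$ on $C$ has a unique barycentre $b_\nu$, and the map $\beta\colon\mathcal V_wC\to C$, $\beta(\nu)=b_\nu$, is continuous and is the structure map of a $\mathcal V_w$-algebra on $C$. Moreover, $C$ is sober and is a topological cone. -/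

import Mathlib

open Set Filter Topology MeasureTheory TopologicalSpace
open scoped NNReal ENNReal

universe u

/-! ### Continuous valuations -/

/-- A continuous valuation on a topological space: a strict, monotone, modular and
Scott-continuous map from the open subsets to `[0, ∞]`. -/
structure ContValuation (X : Type u) [TopologicalSpace X] where
  toFun : Opens X → ℝ≥0∞
  strict : toFun ⊥ = 0
  mono : Monotone toFun
  modular : ∀ U V : Opens X, toFun U + toFun V = toFun (U ⊔ V) + toFun (U ⊓ V)
  scott : ∀ S : Set (Opens X), S.Nonempty → DirectedOn (· ≤ ·) S →
    toFun (sSup S) = ⨆ U ∈ S, toFun U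

/-- The open set `h⁻¹ (a, ∞]` for a lower semi-continuous `h`. -/
def superlevel {X : Type u} [TopologicalSpace X] (h : X → ℝ≥0∞) (hh : LowerSemicontinuous h)
    (a : ℝ≥0∞) : Opens X :=
  ⟨h ⁻¹' Ioi a, hh.isOpen_preimage a⟩

namespace ContValuation

variable {X : Type u} [TopologicalSpace X]

instance : CoeFun (ContValuation X) (fun _ => Opens X → ℝ≥0∞) := ⟨ContValuation.toFun⟩

/-- The Choquet-type integral `∫ h dμ = ∫₀^∞ μ (h⁻¹ (r, ∞]) dr`. -/
noncomputable def integral (μ : ContValuation X) (h : X → ℝ≥0∞) (hh : LowerSemicontinuous h) :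
    ℝ≥0∞ :=
  ∫⁻ r in Ioi (0 : ℝ), μ (superlevel h hh (ENNReal.ofReal r))

/-- The weak topology on the set of continuous valuations, generated by the sets
`[U > r] = {μ | μ U > r}`. -/
instance weakTopology : TopologicalSpace (ContValuation X) :=
  generateFrom {s | ∃ (U : Opens X) (r : ℝ≥0), s = {μ : ContValuation X | (r : ℝ≥0∞) < μ U}}

theorem lowerSemicontinuous_eval (U : Opens X) :
    LowerSemicontinuous (fun μ : ContValuation X => μ U) := by
  rw [lowerSemicontinuous_iff_isOpen_preimage]
  intro y
  induction y with
  | top => simp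
  | coe r => exact isOpen_generateFrom_of_mem ⟨U, r, rfl⟩

/-- The Dirac mass at `x`. -/
noncomputable def dirac (x : X) : ContValuation X where
  toFun U := (U : Set X).indicator 1 x
  strict := by simp
  mono U V h := indicator_le_indicator_of_subset (by exact h) (fun _ => zero_le) x
  modular U V := by
    by_cases h1 : x ∈ U <;> by_cases h2 : x ∈ V <;> simp [indicator, h1, h2]
  scott S _ _ := by
    apply le_antisymm
    · by_cases h : x ∈ sSup S
      · obtain ⟨U, hU, hx⟩ := Opens.mem_sSup.1 h
        exact le_trans (by simp only [indicator]; split_ifs <;> simp_all)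
          (le_iSup₂ (f := fun (U : Opens X) (_ : U ∈ S) => (U : Set X).indicator 1 x) U hU)
      · rw [indicator_of_notMem (by exact h)]; exact zero_le
    · exact iSup₂_le fun U hU =>
        indicator_le_indicator_of_subset (le_sSup hU : U ≤ sSup S) (fun _ => zero_le) x

/-- The action of the functor on a continuous map: `map f μ V = μ (f⁻¹ V)`. -/
def map {Y : Type u} [TopologicalSpace Y] (f : X → Y) (hf : Continuous f)
    (μ : ContValuation X) : ContValuation Y where
  toFun V := μ (Opens.comap ⟨f, hf⟩ V)
  strict := by simpa using μ.strict
  mono U V h := μ.mono (Opens.comap_mono _ h)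
  modular U V := by
    exact μ.modular _ _
  scott S hS hd := by
    rw [sSup_eq_iSup, map_iSup₂, ← sSup_image, μ.scott _ (hS.image _), iSup_image]
    rintro _ ⟨U, hU, rfl⟩ _ ⟨V, hV, rfl⟩
    obtain ⟨W, hW, h1, h2⟩ := hd U hU V hV
    exact ⟨_, ⟨W, hW, rfl⟩, Opens.comap_mono _ h1, Opens.comap_mono _ h2⟩

/-! ### Additivity and Scott-continuity of the integral, by dyadic sums -/

theorem lintegral_dyadic (N : ℕ) (Ψ : ℕ → ℝ≥0∞) :
    ∫⁻ r in Ioi (0 : ℝ), Ψ ⌊r * 2 ^ N⌋₊ = (2 ^ N)⁻¹ * ∑' k, Ψ k := by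
  have h2 : (0 : ℝ) < 2 ^ N := by positivity
  have hU : Ici (0 : ℝ) = ⋃ k : ℕ, {r : ℝ | 0 ≤ r ∧ ⌊r * 2 ^ N⌋₊ = k} := by
    ext r; simp
  have hI : ∀ k : ℕ, {r : ℝ | 0 ≤ r ∧ ⌊r * 2 ^ N⌋₊ = k}
      = Ico ((k : ℝ) / 2 ^ N) ((k + 1 : ℝ) / 2 ^ N) := by
    intro k
    ext r
    simp only [mem_ofPred_eq, mem_Ico, div_le_iff₀ h2, lt_div_iff₀ h2]
    constructor
    · rintro ⟨h, rfl⟩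
      exact ⟨Nat.floor_le (by positivity), Nat.lt_floor_add_one _⟩
    · rintro ⟨h, h'⟩
      have h0 : 0 ≤ r * 2 ^ N := le_trans (Nat.cast_nonneg k) h
      exact ⟨nonneg_of_mul_nonneg_left h0 h2, (Nat.floor_eq_iff h0).2 ⟨h, h'⟩⟩
  rw [setLIntegral_congr Ioi_ae_eq_Ici, hU, lintegral_iUnion]
  · rw [← ENNReal.tsum_mul_left]
    congr 1
    ext k
    have hm : MeasurableSet {r : ℝ | 0 ≤ r ∧ ⌊r * 2 ^ N⌋₊ = k} := by
      rw [hI]; exact measurableSet_Ico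
    rw [setLIntegral_congr_fun (g := fun _ => Ψ k) hm (fun r hr => by simp only [hr.2]),
      setLIntegral_const, hI, Real.volume_Ico, mul_comm]
    congr 1
    rw [← sub_div, add_sub_cancel_left, one_div, ENNReal.ofReal_inv_of_pos h2,
      ENNReal.ofReal_pow (by norm_num)]
    simp
  · intro k; rw [hI]; exact measurableSet_Ico
  · intro i j hij
    refine disjoint_left.2 fun r h1 h2 => hij (h1.2.symm.trans h2.2)

/-- The `N`-th dyadic lower sum of `φ`. -/
noncomputable def dyadicSum (φ : ℝ → ℝ≥0∞) (N : ℕ) : ℝ≥0∞ :=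
  (2 ^ N)⁻¹ * ∑ k ∈ Finset.range (N * 2 ^ N), φ ((k + 1 : ℝ) / 2 ^ N)

theorem dyadicSum_eq (φ : ℝ → ℝ≥0∞) (N : ℕ) :
    dyadicSum φ N = ∫⁻ r in Ioi (0 : ℝ),
      if ⌊r * 2 ^ N⌋₊ < N * 2 ^ N then φ ((⌊r * 2 ^ N⌋₊ + 1 : ℝ) / 2 ^ N) else 0 := by
  rw [lintegral_dyadic N (fun k => if k < N * 2 ^ N then φ ((k + 1 : ℝ) / 2 ^ N) else 0),
    tsum_eq_sum (s := Finset.range (N * 2 ^ N)), dyadicSum]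
  · congr 1
    refine Finset.sum_congr rfl fun k hk => ?_
    rw [if_pos (Finset.mem_range.1 hk)]
  · intro k hk
    rw [if_neg (by simpa using hk)]

theorem monotone_dyadic {φ : ℝ → ℝ≥0∞} (hφ : Antitone φ) {r : ℝ} (hr : 0 < r) :
    Monotone fun N : ℕ =>
      if ⌊r * 2 ^ N⌋₊ < N * 2 ^ N then φ ((⌊r * 2 ^ N⌋₊ + 1 : ℝ) / 2 ^ N) else 0 := by
  refine monotone_nat_of_le_succ fun N => ?_
  by_cases h : ⌊r * 2 ^ N⌋₊ < N * 2 ^ N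
  · have h1 : ⌊r * 2 ^ (N + 1)⌋₊ < 2 * (⌊r * 2 ^ N⌋₊ + 1) := by
      rw [Nat.floor_lt (by positivity)]
      push_cast
      have := Nat.lt_floor_add_one (r * 2 ^ N)
      rw [pow_succ]
      linarith
    have h3 : ⌊r * 2 ^ (N + 1)⌋₊ < (N + 1) * 2 ^ (N + 1) := by
      have h5 : (N + 1) * 2 ^ (N + 1) = 2 * (N * 2 ^ N) + 2 * 2 ^ N := by ring
      omega
    rw [if_pos h, if_pos h3]
    apply hφ
    rw [div_le_div_iff₀ (by positivity) (by positivity)]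
    have h4 : (⌊r * 2 ^ (N + 1)⌋₊ + 1 : ℝ) ≤ 2 * (⌊r * 2 ^ N⌋₊ + 1) := by exact_mod_cast h1
    rw [pow_succ (2 : ℝ) N] at *
    nlinarith [show (0 : ℝ) < 2 ^ N by positivity]
  · rw [if_neg h]; exact zero_le

theorem monotone_dyadicSum {φ : ℝ → ℝ≥0∞} (hφ : Antitone φ) : Monotone (dyadicSum φ) := by
  intro N M h
  rw [dyadicSum_eq, dyadicSum_eq]
  exact setLIntegral_mono' measurableSet_Ioi fun r hr => monotone_dyadic hφ hr h

theorem lintegral_eq_iSup_dyadicSum {φ : ℝ → ℝ≥0∞} (hφ : Antitone φ)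
    (hr : ∀ r, 0 < r → φ r = ⨆ s > r, φ s) :
    ∫⁻ r in Ioi (0 : ℝ), φ r = ⨆ N, dyadicSum φ N := by
  simp_rw [dyadicSum_eq]
  rw [← lintegral_iSup']
  · refine setLIntegral_congr_fun measurableSet_Ioi fun r (h0 : 0 < r) => ?_
    apply le_antisymm
    · rw [hr r h0]
      refine iSup₂_le fun s hs => ?_
      obtain ⟨n, hn⟩ := exists_nat_gt r
      obtain ⟨m, hm⟩ := exists_pow_lt_of_lt_one (sub_pos.2 hs) (show (1 / 2 : ℝ) < 1 by norm_num)
      refine le_trans ?_ (le_iSup _ (max n m))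
      set N := max n m
      have h2 : (0 : ℝ) < 2 ^ N := by positivity
      have hf : (⌊r * 2 ^ N⌋₊ : ℝ) ≤ r * 2 ^ N := Nat.floor_le (by positivity)
      have hN : r < N := hn.trans_le (by exact_mod_cast le_max_left n m)
      have h3 : ⌊r * 2 ^ N⌋₊ < N * 2 ^ N := by
        rw [Nat.floor_lt (by positivity)]
        push_cast
        exact mul_lt_mul_of_pos_right hN h2
      rw [if_pos h3]
      apply hφ
      rw [div_le_iff₀ h2]
      have h4 : (1 / 2 : ℝ) ^ N < s - r :=
        (pow_le_pow_of_le_one (by norm_num) (by norm_num) (le_max_right n m)).trans_lt hm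
      have h5 : (1 / 2 : ℝ) ^ N * 2 ^ N = 1 := by rw [← mul_pow]; norm_num
      nlinarith
    · refine iSup_le fun N => ?_
      split_ifs
      · apply hφ
        rw [le_div_iff₀ (by positivity)]
        exact (Nat.lt_floor_add_one _).le
      · exact zero_le
  · intro N
    refine Measurable.aemeasurable ?_
    exact (measurable_from_top (f := fun k : ℕ =>
      if k < N * 2 ^ N then φ ((k + 1 : ℝ) / 2 ^ N) else 0)).comp
        (Nat.measurable_floor.comp (measurable_id.mul_const _))
  · exact (ae_restrict_iff' measurableSet_Ioi).2
      (Eventually.of_forall fun r hr => monotone_dyadic hφ hr)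

theorem antitone_superlevel (μ : ContValuation X) {h : X → ℝ≥0∞} (hh : LowerSemicontinuous h) :
    Antitone fun r : ℝ => μ (superlevel h hh (ENNReal.ofReal r)) :=
  fun _ _ hrs => μ.mono fun _ hx => lt_of_le_of_lt (ENNReal.ofReal_le_ofReal hrs) hx

theorem scott_iSup (μ : ContValuation X) {ι : Type*} [Nonempty ι] {U : ι → Opens X}
    (hU : Directed (· ≤ ·) U) : μ (⨆ i, U i) = ⨆ i, μ (U i) := by
  rw [← sSup_range, μ.scott _ (range_nonempty U) hU.directedOn_range, iSup_range]

theorem integral_eq_iSup (μ : ContValuation X) {h : X → ℝ≥0∞} (hh : LowerSemicontinuous h) :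
    μ.integral h hh = ⨆ N, dyadicSum (fun r => μ (superlevel h hh (ENNReal.ofReal r))) N := by
  refine lintegral_eq_iSup_dyadicSum (μ.antitone_superlevel hh) fun r hr => ?_
  have : Nonempty {s : ℝ // s > r} := ⟨⟨r + 1, by simp⟩⟩
  rw [iSup_subtype', ← μ.scott_iSup
    (U := fun s : {s : ℝ // s > r} => superlevel h hh (ENNReal.ofReal s))]
  · congr 1
    ext x
    simp only [superlevel, Opens.coe_mk, Opens.coe_iSup, mem_preimage, mem_Ioi, mem_iUnion]
    constructor
    · intro hx
      obtain ⟨q, h1, h2⟩ := ENNReal.lt_iff_exists_real_btwn.1 hx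
      exact ⟨⟨q, (ENNReal.ofReal_lt_ofReal_iff_of_nonneg hr.le).1 h2.1⟩, h2.2⟩
    · rintro ⟨⟨s, hs⟩, h2⟩
      exact lt_of_le_of_lt (ENNReal.ofReal_le_ofReal hs.le) h2
  · refine directed_of_isDirected_ge (r := (· ≤ ·)) fun s t hst => ?_
    exact fun x hx => lt_of_le_of_lt (ENNReal.ofReal_le_ofReal hst) hx

theorem integral_congr (μ : ContValuation X) {f g : X → ℝ≥0∞} (hf : LowerSemicontinuous f)
    (hg : LowerSemicontinuous g) (h : f = g) : μ.integral f hf = μ.integral g hg := by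
  subst h; rfl

theorem integral_mono (μ : ContValuation X) {f g : X → ℝ≥0∞} (hf : LowerSemicontinuous f)
    (hg : LowerSemicontinuous g) (h : f ≤ g) : μ.integral f hf ≤ μ.integral g hg :=
  lintegral_mono fun _ => μ.mono fun x hx => lt_of_lt_of_le hx (h x)

/-- The integral preserves directed suprema. -/
theorem integral_iSup (μ : ContValuation X) {ι : Type*} [Nonempty ι] {f : ι → X → ℝ≥0∞}
    (hf : ∀ i, LowerSemicontinuous (f i)) {g : X → ℝ≥0∞} (hg : LowerSemicontinuous g)
    (hd : Directed (· ≤ ·) f) (h : ∀ x, g x = ⨆ i, f i x) :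
    μ.integral g hg = ⨆ i, μ.integral (f i) (hf i) := by
  have hs : ∀ r : ℝ, μ (superlevel g hg (ENNReal.ofReal r))
      = ⨆ i, μ (superlevel (f i) (hf i) (ENNReal.ofReal r)) := by
    intro r
    rw [← μ.scott_iSup (U := fun i => superlevel (f i) (hf i) (ENNReal.ofReal r))]
    · congr 1
      ext x
      simp [superlevel, h, lt_iSup_iff]
    · intro i j
      obtain ⟨k, h1, h2⟩ := hd i j
      exact ⟨k, fun x hx => lt_of_lt_of_le hx (h1 x), fun x hx => lt_of_lt_of_le hx (h2 x)⟩
  simp_rw [integral_eq_iSup]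
  rw [iSup_comm]
  congr 1
  ext N
  simp_rw [dyadicSum, hs]
  rw [ENNReal.finsetSum_iSup, ENNReal.mul_iSup]
  intro i j
  obtain ⟨k, h1, h2⟩ := hd i j
  exact ⟨k, fun a => ⟨μ.mono fun x hx => lt_of_lt_of_le hx (h1 x),
    μ.mono fun x hx => lt_of_lt_of_le hx (h2 x)⟩⟩

/-- `moreThan L k` is the set of points lying in more than `k` members of the list `L`. -/
def moreThan : List (Opens X) → ℕ → Opens X
  | [], _ => ⊥
  | U :: L, 0 => U ⊔ moreThan L 0
  | U :: L, k + 1 => moreThan L (k + 1) ⊔ (U ⊓ moreThan L k)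

open Classical in
theorem mem_moreThan (L : List (Opens X)) (k : ℕ) (x : X) :
    x ∈ moreThan L k ↔ k < (L.map fun U => if x ∈ U then 1 else 0).sum := by
  induction L generalizing k with
  | nil => simp [moreThan]
  | cons U L ih =>
    cases k with
    | zero => by_cases hx : x ∈ U <;> simp [moreThan, ih, hx, Opens.mem_sup]
    | succ k =>
      by_cases hx : x ∈ U <;> simp [moreThan, ih, hx, Opens.mem_sup, Opens.mem_inf]
      omega

theorem moreThan_anti (L : List (Opens X)) : Antitone (moreThan L) := by
  classical
  intro i j hij x hx
  exact (mem_moreThan L i x).2 (hij.trans_lt ((mem_moreThan L j x).1 hx))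

theorem moreThan_eq_bot (L : List (Opens X)) {k : ℕ} (hk : L.length ≤ k) :
    moreThan L k = ⊥ := by
  induction L generalizing k with
  | nil => rfl
  | cons U L ih =>
    cases k with
    | zero => simp at hk
    | succ k =>
      simp only [List.length_cons, Nat.succ_le_succ_iff] at hk
      simp [moreThan, ih hk, ih (hk.trans (Nat.le_succ k))]

theorem sum_moreThan_cons (μ : ContValuation X) (U : Opens X) (L : List (Opens X)) (n : ℕ) :
    ∑ k ∈ Finset.range (n + 1), μ (moreThan (U :: L) k) + μ (U ⊓ moreThan L n)
      = ∑ k ∈ Finset.range (n + 1), μ (moreThan L k) + μ U := by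
  induction n with
  | zero =>
    simp only [zero_add, Finset.range_one, Finset.sum_singleton, moreThan]
    rw [← μ.modular, add_comm]
  | succ n ih =>
    have e : (U ⊓ moreThan L n) ⊓ moreThan L (n + 1) = U ⊓ moreThan L (n + 1) := by
      rw [inf_assoc, inf_eq_right.2 (moreThan_anti L n.le_succ)]
    have m := μ.modular (moreThan L (n + 1)) (U ⊓ moreThan L n)
    rw [inf_comm (moreThan L (n + 1)), e] at m
    rw [Finset.sum_range_succ, Finset.sum_range_succ _ (n + 1), moreThan, add_assoc, ← m,
      add_right_comm, ← ih]
    ring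

theorem sum_moreThan (μ : ContValuation X) (L : List (Opens X)) {n : ℕ} (hn : L.length ≤ n) :
    ∑ k ∈ Finset.range n, μ (moreThan L k) = (L.map μ).sum := by
  induction L generalizing n with
  | nil => simp [moreThan, μ.strict]
  | cons U L ih =>
    obtain ⟨m, rfl⟩ : ∃ m, n = m + 1 := ⟨n - 1, by simp at hn; omega⟩
    simp only [List.length_cons, Nat.succ_le_succ_iff] at hn
    have := μ.sum_moreThan_cons U L m
    rw [moreThan_eq_bot L hn, inf_bot_eq, μ.strict, add_zero, ih (hn.trans m.le_succ)] at this
    rw [this, List.map_cons, List.sum_cons, add_comm]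

open Classical in
/-- The step function `2⁻ᴺ ∑ χ_U`, the sum being over the members `U` of `L`. -/
noncomputable def step (L : List (Opens X)) (N : ℕ) (x : X) : ℝ≥0∞ :=
  (2 ^ N)⁻¹ * ((L.map fun U => if x ∈ U then 1 else 0).sum : ℕ)

theorem lt_step_iff (L : List (Opens X)) (N : ℕ) (x : X) {r : ℝ} (hr : 0 ≤ r) :
    ENNReal.ofReal r < step L N x ↔ x ∈ moreThan L ⌊r * 2 ^ N⌋₊ := by
  rw [mem_moreThan, Nat.floor_lt (by positivity), step]
  generalize (List.sum _ : ℕ) = c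
  have e : ((2 : ℝ≥0∞) ^ N)⁻¹ * (c : ℝ≥0∞) = ENNReal.ofReal (c / 2 ^ N) := by
    rw [ENNReal.ofReal_div_of_pos (by positivity), ENNReal.ofReal_pow (by norm_num)]
    simp [div_eq_mul_inv, mul_comm]
  rw [e, ENNReal.ofReal_lt_ofReal_iff_of_nonneg hr, lt_div_iff₀ (by positivity)]

theorem lowerSemicontinuous_step (L : List (Opens X)) (N : ℕ) :
    LowerSemicontinuous (step L N) := by
  rw [lowerSemicontinuous_iff_isOpen_preimage]
  intro y
  rcases eq_or_ne y ⊤ with rfl | hy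
  · simp
  · have : step L N ⁻¹' Ioi y = (moreThan L ⌊y.toReal * 2 ^ N⌋₊ : Set X) := by
      ext x
      rw [SetLike.mem_coe, ← lt_step_iff L N x ENNReal.toReal_nonneg, ENNReal.ofReal_toReal hy]
      rfl
    rw [this]
    exact (moreThan L _).isOpen

theorem integral_step (μ : ContValuation X) (L : List (Opens X)) (N : ℕ) :
    μ.integral (step L N) (lowerSemicontinuous_step L N) = (2 ^ N)⁻¹ * (L.map μ).sum := by
  have e : ∑' k, μ (moreThan L k) = ∑ k ∈ Finset.range L.length, μ (moreThan L k) :=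
    tsum_eq_sum fun k hk => by rw [moreThan_eq_bot L (by simpa using hk), μ.strict]
  rw [← μ.sum_moreThan L le_rfl, ← e, ← lintegral_dyadic, integral]
  refine setLIntegral_congr_fun measurableSet_Ioi fun r (hr : 0 < r) => ?_
  congr 1
  ext x
  exact lt_step_iff L N x hr.le

/-- The list of the superlevel sets of `f` at the heights `(k + 1) / 2ᴺ`, `k < N 2ᴺ`. -/
noncomputable def levels (f : X → ℝ≥0∞) (hf : LowerSemicontinuous f) (N : ℕ) : List (Opens X) :=
  (List.range (N * 2 ^ N)).map fun k : ℕ =>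
    superlevel f hf (ENNReal.ofReal ((k + 1 : ℝ) / 2 ^ N))

theorem sum_map_range (a : ℕ → ℝ≥0∞) (n : ℕ) :
    ((List.range n).map a).sum = ∑ k ∈ Finset.range n, a k := by
  induction n with
  | zero => simp
  | succ n ih => simp [List.range_succ, Finset.sum_range_succ, ih]

theorem step_append (L M : List (Opens X)) (N : ℕ) (x : X) :
    step (L ++ M) N x = step L N x + step M N x := by
  simp [step, mul_add]

theorem step_levels {f : X → ℝ≥0∞} (hf : LowerSemicontinuous f) (N : ℕ) (x : X) :
    step (levels f hf N) N x
      = dyadicSum (fun r => if ENNReal.ofReal r < f x then 1 else 0) N := by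
  classical
  rw [step, dyadicSum, ← sum_map_range, levels, List.map_map]
  congr 1
  generalize List.range (N * 2 ^ N) = l
  induction l with
  | nil => simp
  | cons k l ih =>
    rw [List.map_cons, List.sum_cons, Nat.cast_add, ih, List.map_cons, List.sum_cons]
    congr 1
    simp [superlevel, ← SetLike.mem_coe]

theorem antitone_ite (a : ℝ≥0∞) :
    Antitone fun r : ℝ => if ENNReal.ofReal r < a then (1 : ℝ≥0∞) else 0 := by
  intro r s h
  simp only
  split_ifs with h1 h2 h2
  · exact le_rfl
  · exact absurd ((ENNReal.ofReal_le_ofReal h).trans_lt h1) h2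
  · exact zero_le
  · exact le_rfl

theorem monotone_step_levels {f : X → ℝ≥0∞} (hf : LowerSemicontinuous f) :
    Monotone fun N => step (levels f hf N) N := by
  intro N M h x
  simp only [step_levels]
  exact monotone_dyadicSum (antitone_ite _) h

theorem iSup_step_levels {f : X → ℝ≥0∞} (hf : LowerSemicontinuous f) (x : X) :
    ⨆ N, step (levels f hf N) N x = f x := by
  have h1 := (dirac x).integral_eq_iSup hf
  have h2 : ∀ r : ℝ, dirac x (superlevel f hf (ENNReal.ofReal r))
      = if ENNReal.ofReal r < f x then 1 else 0 := by
    intro r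
    simp [dirac, superlevel, indicator]
  simp_rw [h2] at h1
  simp_rw [step_levels]
  rw [← h1, integral]
  simp_rw [h2]
  have h3 : ∀ r : ℝ, (if ENNReal.ofReal r < f x then (1 : ℝ≥0∞) else 0)
      = {r : ℝ | ENNReal.ofReal r < f x}.indicator 1 r := fun r => by simp [indicator]
  have hm : MeasurableSet {r : ℝ | ENNReal.ofReal r < f x} :=
    measurableSet_lt ENNReal.measurable_ofReal measurable_const
  simp_rw [h3]
  rw [lintegral_indicator_one hm, Measure.restrict_apply hm]
  rcases eq_or_ne (f x) ⊤ with h | h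
  · have : {r : ℝ | ENNReal.ofReal r < f x} ∩ Ioi 0 = Ioi 0 := by ext; simp [h]
    rw [this, Real.volume_Ioi, h]
  · have : {r : ℝ | ENNReal.ofReal r < f x} ∩ Ioi 0 = Ioo 0 (f x).toReal := by
      ext r
      simp only [mem_inter_iff, mem_ofPred_eq, mem_Ioi, mem_Ioo]
      rw [and_comm]
      refine and_congr_right fun hr => ?_
      rw [ENNReal.ofReal_lt_iff_lt_toReal hr.le h]
    rw [this, Real.volume_Ioo, sub_zero, ENNReal.ofReal_toReal h]

theorem integral_levels (μ : ContValuation X) {f : X → ℝ≥0∞} (hf : LowerSemicontinuous f)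
    (N : ℕ) : (2 ^ N)⁻¹ * ((levels f hf N).map μ).sum
      = dyadicSum (fun r => μ (superlevel f hf (ENNReal.ofReal r))) N := by
  rw [levels, List.map_map, sum_map_range, dyadicSum]
  rfl

theorem integral_add (μ : ContValuation X) {f g s : X → ℝ≥0∞} (hf : LowerSemicontinuous f)
    (hg : LowerSemicontinuous g) (hs : LowerSemicontinuous s) (h : ∀ x, s x = f x + g x) :
    μ.integral s hs = μ.integral f hf + μ.integral g hg := by
  have hmono : Monotone fun N => step (levels f hf N ++ levels g hg N) N := by
    intro N M hNM x
    simp only [step_append]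
    exact add_le_add (monotone_step_levels hf hNM x) (monotone_step_levels hg hNM x)
  rw [μ.integral_iSup (f := fun N => step (levels f hf N ++ levels g hg N) N)
    (fun N => lowerSemicontinuous_step _ N) hs hmono.directed_le]
  · simp_rw [integral_step, List.map_append, List.sum_append, mul_add, integral_levels]
    rw [integral_eq_iSup, integral_eq_iSup, ENNReal.iSup_add_iSup_of_monotone]
    · exact monotone_dyadicSum (μ.antitone_superlevel hf)
    · exact monotone_dyadicSum (μ.antitone_superlevel hg)
  · intro x
    simp_rw [step_append]
    rw [h, ← ENNReal.iSup_add_iSup_of_monotone (fun _ _ h => monotone_step_levels hf h x)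
      (fun _ _ h => monotone_step_levels hg h x), iSup_step_levels, iSup_step_levels]

/-- The multiplication of the monad: `mult ϖ U = ∫ μ U dϖ(μ)`. -/
noncomputable def mult (ϖ : ContValuation (ContValuation X)) : ContValuation X where
  toFun U := ϖ.integral (fun μ => μ U) (lowerSemicontinuous_eval U)
  strict := by
    have : ∀ r : ℝ, superlevel (fun μ : ContValuation X => μ ⊥) (lowerSemicontinuous_eval ⊥)
        (ENNReal.ofReal r) = ⊥ := by
      intro r; ext μ; simp [superlevel, μ.strict]
    simp [integral, this, ϖ.strict]
  mono U V h := ϖ.integral_mono _ _ fun μ => μ.mono h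
  modular U V := by
    rw [← ϖ.integral_add (s := fun μ => μ U + μ V) _ _
        ((lowerSemicontinuous_eval U).add (lowerSemicontinuous_eval V)) (fun _ => rfl),
      ← ϖ.integral_add (s := fun μ => μ (U ⊔ V) + μ (U ⊓ V)) _ _
        ((lowerSemicontinuous_eval _).add (lowerSemicontinuous_eval _)) (fun _ => rfl)]
    exact ϖ.integral_congr _ _ (funext fun μ => μ.modular U V)
  scott S hS hd := by
    have : Nonempty S := hS.to_subtype
    rw [iSup_subtype']
    refine ϖ.integral_iSup (f := fun (U : S) (μ : ContValuation X) => μ U)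
      (fun U => lowerSemicontinuous_eval _) _ ?_ fun μ => ?_
    · intro U V
      obtain ⟨W, hW, h1, h2⟩ := hd U U.2 V V.2
      exact ⟨⟨W, hW⟩, fun μ => μ.mono h1, fun μ => μ.mono h2⟩
    · rw [μ.scott S hS hd, iSup_subtype']

/-- `(A, α)` is an Eilenberg–Moore algebra of the valuation monad, with unit `dirac` and
multiplication `mult`, on the category of `T₀` spaces: `α` is a continuous map with
`α ∘ η = id` and `α ∘ m = α ∘ T α`. -/
structure IsStructureMap {A : Type u} [TopologicalSpace A] [T0Space A]
    (α : ContValuation A → A) : Prop where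
  continuous : Continuous α
  unit : ∀ x : A, α (dirac x) = x
  assoc : ∀ ϖ : ContValuation (ContValuation A), α (mult ϖ) = α (map α continuous ϖ)

end ContValuation

/-! ### Cones

A cone is a commutative monoid `C` with `[Module ℝ≥0 C]`. The scalars `ℝ≥0` carry the Scott
topology (whose non-trivial open sets are the `(r, ∞)`), not the Euclidean one. -/

/-- A semitopological cone: a cone with a `T₀` topology for which addition and scalar
multiplication are separately continuous. -/
class SemitopologicalCone (C : Type u) [TopologicalSpace C] [AddCommMonoid C] [Module ℝ≥0 C] :
    Prop extends T0Space C where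
  continuous_add_left : ∀ x : C, Continuous fun y : C => x + y
  continuous_add_right : ∀ y : C, Continuous fun x : C => x + y
  continuous_smul_left : ∀ r : ℝ≥0, Continuous fun x : C => r • x
  continuous_smul_right : ∀ x : C,
    Continuous fun r : Topology.WithScott ℝ≥0 => Topology.WithScott.ofScott r • x

/-- A topological cone: a cone with a `T₀` topology for which addition and scalar
multiplication are jointly continuous. -/
class TopologicalCone (C : Type u) [TopologicalSpace C] [AddCommMonoid C] [Module ℝ≥0 C] :
    Prop extends T0Space C where
  continuous_add : Continuous fun p : C × C => p.1 + p.2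
  continuous_smul :
    Continuous fun p : Topology.WithScott ℝ≥0 × C => Topology.WithScott.ofScott p.1 • p.2

/-- A half-space: a convex subset with convex complement. -/
def IsHalfSpace {C : Type u} [AddCommMonoid C] [Module ℝ≥0 C] (H : Set C) : Prop :=
  Convex ℝ≥0 H ∧ Convex ℝ≥0 Hᶜ

/-- The topology has a subbase of open half-spaces. -/
def IsLocallyLinear (C : Type u) [t : TopologicalSpace C] [AddCommMonoid C] [Module ℝ≥0 C] :
    Prop :=
  ∃ S : Set (Set C), (∀ H ∈ S, IsOpen H ∧ IsHalfSpace H) ∧ t = generateFrom S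

/-- `b` is a barycentre of `ν`: `Λ b = ∫ Λ dν` for every lower semi-continuous linear map
`Λ : C → [0, ∞]`. -/
def IsBarycentre {C : Type u} [TopologicalSpace C] [AddCommMonoid C] [Module ℝ≥0 C]
    (b : C) (ν : ContValuation C) : Prop :=
  ∀ (Λ : C →ₗ[ℝ≥0] ℝ≥0∞) (hΛ : LowerSemicontinuous Λ), Λ b = ν.integral Λ hΛ

/-! ### Further properties of the integral -/

namespace ContValuation

variable {X : Type u} [TopologicalSpace X]

/-! Everything is tested against the lower semi-continuous linear maps `Λ : C → [0, ∞]`, and the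
point is that there are enough of them. In a semitopological cone the Scott topology on the scalars
forces every open set to be stable under enlarging scalars and under adding arbitrary points. Hence
an open half-space containing `0` is the whole cone, and any other one equals `{Λ > 1}` for its
gauge `Λ`: convexity of the half-space makes the gauge superadditive, convexity of the complement
makes it subadditive (`IsHalfSpace.exists_linear`). So in a locally linear cone the sets `{Λ > 1}`
form a subbase (`IsLocallyLinear.eq_generateFrom`).

By the `T₀` axiom such maps separate points, whence barycentres are unique. A map `f` into `C` is
continuous as soon as all sets `{Λ ∘ f > 1}` are open; for `β` these are the sets `{ν | ∫ Λ dν >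
1}`, open because integration is weakly lower semi-continuous. The algebra laws become `∫ Λ dδ_x = Λ
x` and the interchange formula `integral_mult`, both read off from dyadic sums. Joint continuity of
the cone operations is checked on the same subbase.

For sobriety, an irreducible closed set `Z` is turned into the valuation with value `1` exactly on
the open sets that meet `Z`. Its barycentre belongs to a subbasic open set exactly when that set
meets `Z`, so it is a generic point of `Z`. -/

theorem integral_dirac (x : X) {f : X → ℝ≥0∞} (hf : LowerSemicontinuous f) :
    (dirac x).integral f hf = f x := by
  rw [integral_eq_iSup, ← iSup_step_levels hf x]
  congr 1
  ext N
  rw [step_levels]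
  congr 1
  ext r
  simp [dirac, superlevel, indicator]

theorem integral_mono_valuation {μ ν : ContValuation X} (h : ∀ U, μ U ≤ ν U) {f : X → ℝ≥0∞}
    (hf : LowerSemicontinuous f) : μ.integral f hf ≤ ν.integral f hf :=
  lintegral_mono fun _ => h _

theorem integral_map {Y : Type u} [TopologicalSpace Y] (g : X → Y) (hg : Continuous g)
    (μ : ContValuation X) {f : Y → ℝ≥0∞} (hf : LowerSemicontinuous f) :
    (map g hg μ).integral f hf = μ.integral (f ∘ g) (hf.comp hg) :=
  rfl

theorem integral_zero (μ : ContValuation X) (h : LowerSemicontinuous fun _ : X => (0 : ℝ≥0∞)) :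
    μ.integral (fun _ => 0) h = 0 := by
  have : ∀ r : ℝ, superlevel (fun _ : X => (0 : ℝ≥0∞)) h (ENNReal.ofReal r) = ⊥ := by
    intro r; ext x; simp [superlevel]
  simp [integral, this, μ.strict]

theorem integral_finset_sum (μ : ContValuation X) {ι : Type*} (s : Finset ι)
    {f : ι → X → ℝ≥0∞} (hf : ∀ i, LowerSemicontinuous (f i))
    (hs : LowerSemicontinuous fun x => ∑ i ∈ s, f i x) :
    μ.integral (fun x => ∑ i ∈ s, f i x) hs = ∑ i ∈ s, μ.integral (f i) (hf i) := by
  classical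
  induction s using Finset.induction_on with
  | empty => simpa using μ.integral_zero (by simpa using hs)
  | insert i s hi ih =>
    have h : LowerSemicontinuous fun x => ∑ i ∈ s, f i x :=
      lowerSemicontinuous_sum fun i _ => hf i
    rw [Finset.sum_insert hi, ← ih h]
    exact μ.integral_add _ _ _ fun x => Finset.sum_insert hi

theorem lowerSemicontinuous_const_mul {f : X → ℝ≥0∞} (hf : LowerSemicontinuous f) {c : ℝ≥0∞}
    (hc : c ≠ ⊤) : LowerSemicontinuous fun x => c * f x :=
  (ENNReal.continuous_const_mul hc).comp_lowerSemicontinuous hf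
    fun _ _ h => mul_le_mul_right h c

/-- Additivity suffices, since `f` is a sum of `n` copies of `n⁻¹ f`. Only the factors `2⁻ᴺ` of
dyadic sums are needed later. -/
theorem integral_nat_inv_mul (μ : ContValuation X) {n : ℕ} (hn : n ≠ 0) {f : X → ℝ≥0∞}
    (hf : LowerSemicontinuous f) (h : LowerSemicontinuous fun x => (n : ℝ≥0∞)⁻¹ * f x) :
    μ.integral (fun x => (n : ℝ≥0∞)⁻¹ * f x) h = (n : ℝ≥0∞)⁻¹ * μ.integral f hf := by
  have h0 : (n : ℝ≥0∞) ≠ 0 := by exact_mod_cast hn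
  have h1 : (n : ℝ≥0∞) ≠ ⊤ := ENNReal.natCast_ne_top n
  have e : f = fun x => ∑ _i ∈ Finset.range n, (n : ℝ≥0∞)⁻¹ * f x := by
    ext x
    rw [Finset.sum_const, Finset.card_range, nsmul_eq_mul, ← mul_assoc,
      ENNReal.mul_inv_cancel h0 h1, one_mul]
  have hs : LowerSemicontinuous fun x => ∑ _i ∈ Finset.range n, (n : ℝ≥0∞)⁻¹ * f x := e ▸ hf
  rw [μ.integral_congr hf hs e, μ.integral_finset_sum (Finset.range n) (fun _ => h) hs,
    Finset.sum_const, Finset.card_range, nsmul_eq_mul, ← mul_assoc,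
    ENNReal.inv_mul_cancel h0 h1, one_mul]

/-! ### Dyadic sums under the integral, and iterated integrals. -/

theorem lowerSemicontinuous_dyadicSum {φ : X → ℝ → ℝ≥0∞}
    (hφ : ∀ r, LowerSemicontinuous fun x => φ x r) (N : ℕ) :
    LowerSemicontinuous fun x => dyadicSum (φ x) N :=
  lowerSemicontinuous_const_mul (lowerSemicontinuous_sum fun _ _ => hφ _)
    (ENNReal.inv_ne_top.2 (by simp))

theorem integral_dyadicSum (μ : ContValuation X) {φ : X → ℝ → ℝ≥0∞}
    (hφ : ∀ r, LowerSemicontinuous fun x => φ x r) (N : ℕ) :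
    μ.integral (fun x => dyadicSum (φ x) N) (lowerSemicontinuous_dyadicSum hφ N)
      = dyadicSum (fun r => μ.integral (fun x => φ x r) (hφ r)) N := by
  have hs : LowerSemicontinuous fun x =>
      ∑ k ∈ Finset.range (N * 2 ^ N), φ x ((k + 1 : ℝ) / 2 ^ N) :=
    lowerSemicontinuous_sum fun _ _ => hφ _
  have e : ((2 : ℝ≥0∞) ^ N) = ((2 ^ N : ℕ) : ℝ≥0∞) := by simp
  have h := μ.integral_nat_inv_mul (n := 2 ^ N) (by positivity) hs
    (lowerSemicontinuous_const_mul hs (ENNReal.inv_ne_top.2 (by simp)))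
  rw [μ.integral_finset_sum _ (fun k : ℕ => hφ ((k + 1 : ℝ) / 2 ^ N))] at h
  refine Eq.trans (μ.integral_congr _ _ ?_) (h.trans ?_)
  · ext x
    rw [dyadicSum, e]
  · rw [dyadicSum, e]

/-- Integration of a fixed function is lower semi-continuous on the space of valuations. -/
theorem lowerSemicontinuous_integral {f : X → ℝ≥0∞} (hf : LowerSemicontinuous f) :
    LowerSemicontinuous fun μ : ContValuation X => μ.integral f hf := by
  simp_rw [integral_eq_iSup]
  exact lowerSemicontinuous_iSup fun N =>
    lowerSemicontinuous_dyadicSum (fun r => lowerSemicontinuous_eval _) N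

/-- Both sides are suprema over `N` of dyadic sums. These are finite positive combinations, so they
commute with `ϖ.integral`, and on each superlevel set the two sides agree by definition of `mult`.
-/
theorem integral_mult (ϖ : ContValuation (ContValuation X)) {f : X → ℝ≥0∞}
    (hf : LowerSemicontinuous f) :
    (mult ϖ).integral f hf
      = ϖ.integral (fun μ => μ.integral f hf) (lowerSemicontinuous_integral hf) := by
  have hφ : ∀ r : ℝ, LowerSemicontinuous fun μ : ContValuation X =>
      μ (superlevel f hf (ENNReal.ofReal r)) := fun r => lowerSemicontinuous_eval _
  rw [integral_eq_iSup, ϖ.integral_iSup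
    (f := fun N (μ : ContValuation X) =>
      dyadicSum (fun r => μ (superlevel f hf (ENNReal.ofReal r))) N)
    (lowerSemicontinuous_dyadicSum hφ) _ ?_ fun μ => μ.integral_eq_iSup hf]
  · simp_rw [ϖ.integral_dyadicSum hφ]
    rfl
  · exact Monotone.directed_le fun N M h μ => monotone_dyadicSum (μ.antitone_superlevel hf) h

/-! ### Valuations of irreducible sets. -/

open Classical in
/-- The valuation of an irreducible set `Z`: it takes the value `1` on the open sets that
meet `Z`, and `0` on the others. -/
noncomputable def ofIrreducible (Z : Set X) (hZ : IsIrreducible Z) : ContValuation X where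
  toFun U := if (Z ∩ U).Nonempty then 1 else 0
  strict := by simp
  mono U V h := by
    have : (Z ∩ U).Nonempty → (Z ∩ V).Nonempty := fun hU =>
      hU.mono (inter_subset_inter_right Z h)
    by_cases hU : (Z ∩ U).Nonempty <;> simp [hU, this]
  modular U V := by
    have h1 : (Z ∩ (U ⊔ V : Opens X)).Nonempty ↔ (Z ∩ U).Nonempty ∨ (Z ∩ V).Nonempty := by
      rw [Opens.coe_sup, inter_union_distrib_left, union_nonempty]
    have h2 : (Z ∩ (U ⊓ V : Opens X)).Nonempty ↔ (Z ∩ U).Nonempty ∧ (Z ∩ V).Nonempty := by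
      rw [Opens.coe_inf]
      exact ⟨fun h => ⟨h.mono (by grind), h.mono (by grind)⟩,
        fun h => hZ.2 U V U.isOpen V.isOpen h.1 h.2⟩
    simp only [h1, h2]
    by_cases hU : (Z ∩ U).Nonempty <;> by_cases hV : (Z ∩ V).Nonempty <;> simp [hU, hV]
  scott S _ _ := by
    apply le_antisymm
    · split_ifs with h
      · obtain ⟨z, hz, h⟩ := h
        obtain ⟨U, hU, hzU⟩ := Opens.mem_sSup.1 h
        refine le_trans (le_of_eq ?_) (le_iSup₂ (f := fun (U : Opens X) (_ : U ∈ S) =>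
          if (Z ∩ U).Nonempty then (1 : ℝ≥0∞) else 0) U hU)
        exact (if_pos ⟨z, hz, hzU⟩).symm
      · exact zero_le
    · refine iSup₂_le fun U hU => ?_
      have : (Z ∩ U).Nonempty → (Z ∩ (sSup S : Opens X)).Nonempty := fun h =>
        h.mono (inter_subset_inter_right Z (le_sSup hU : U ≤ sSup S))
      by_cases h : (Z ∩ U).Nonempty
      · rw [if_pos h, if_pos (this h)]
      · rw [if_neg h]; exact zero_le

/-- The integral is in fact the supremum of `f` over `Z`; the threshold `1` is all that the subbase
`{Λ > 1}` requires. -/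
theorem one_lt_integral_ofIrreducible_iff {Z : Set X} (hZ : IsIrreducible Z) {f : X → ℝ≥0∞}
    (hf : LowerSemicontinuous f) :
    1 < (ofIrreducible Z hZ).integral f hf ↔ ∃ z ∈ Z, 1 < f z := by
  classical
  constructor
  · contrapose!
    intro h
    calc (ofIrreducible Z hZ).integral f hf
        ≤ ∫⁻ r in Ioi (0 : ℝ), (Iio (1 : ℝ)).indicator 1 r := by
          refine lintegral_mono fun r => ?_
          simp only [ofIrreducible]
          split_ifs with hr
          · obtain ⟨z, hz, hr⟩ := hr
            have : ENNReal.ofReal r < 1 := lt_of_lt_of_le hr (h z hz)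
            rw [indicator_of_mem (by simpa using this)]
            rfl
          · exact zero_le
      _ = 1 := by
          rw [lintegral_indicator_one measurableSet_Iio, Measure.restrict_apply measurableSet_Iio,
            Iio_inter_Ioi, Real.volume_Ioo]
          simp
  · rintro ⟨z, hz, h⟩
    -- The Dirac mass at a point of `Z` is dominated by the valuation of `Z`.
    rw [← integral_dirac z hf] at h
    refine h.trans_le (integral_mono_valuation (fun U => ?_) hf)
    by_cases hU : z ∈ U
    · have : (Z ∩ U).Nonempty := ⟨z, hz, hU⟩
      simp [dirac, ofIrreducible, this, indicator, hU]
    · simp [dirac, hU]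

end ContValuation

/-! ### The gauge of an open half-space -/

section Gauge

variable {C : Type u} [AddCommMonoid C] [Module ℝ≥0 C] {H : Set C}

/-- The gauge (upper Minkowski functional) of `H`: the supremum of the scalars `r` with
`r⁻¹ • x ∈ H`. -/
noncomputable def upperGauge (H : Set C) (x : C) : ℝ≥0∞ :=
  ⨆ (r : ℝ≥0) (_ : r⁻¹ • x ∈ H), (r : ℝ≥0∞)

theorem upperGauge_zero (h0 : (0 : C) ∉ H) : upperGauge H 0 = 0 := by
  simp [upperGauge, h0]

/-- Half of homogeneity; the other half is this inequality for `c⁻¹` at the point `c • x`. -/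
theorem mul_upperGauge_le {c : ℝ≥0} (hc : c ≠ 0) (x : C) :
    c * upperGauge H x ≤ upperGauge H (c • x) := by
  simp only [upperGauge, ENNReal.mul_iSup]
  refine iSup₂_le fun r hr => ?_
  rw [← ENNReal.coe_mul]
  refine le_iSup₂ (f := fun (r : ℝ≥0) (_ : r⁻¹ • c • x ∈ H) => (r : ℝ≥0∞)) (c * r) ?_
  rwa [smul_smul, mul_inv_rev, inv_mul_cancel_right₀ hc]

theorem upperGauge_smul (h0 : (0 : C) ∉ H) (c : ℝ≥0) (x : C) :
    upperGauge H (c • x) = c * upperGauge H x := by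
  rcases eq_or_ne c 0 with rfl | hc
  · simp [upperGauge_zero h0]
  refine le_antisymm ?_ (mul_upperGauge_le hc x)
  have h := mul_upperGauge_le (H := H) (inv_ne_zero hc) (c • x)
  rw [smul_smul, inv_mul_cancel₀ hc, one_smul] at h
  calc upperGauge H (c • x) = (c : ℝ≥0∞) * ((c⁻¹ : ℝ≥0) * upperGauge H (c • x)) := by
        rw [← mul_assoc, ← ENNReal.coe_mul, mul_inv_cancel₀ hc, ENNReal.coe_one, one_mul]
    _ ≤ c * upperGauge H x := mul_le_mul_right h _

theorem inv_smul_add_eq {a b : ℝ≥0} (ha : a ≠ 0) (hb : b ≠ 0) (x y : C) :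
    (a + b)⁻¹ • (x + y) = (a / (a + b)) • a⁻¹ • x + (b / (a + b)) • b⁻¹ • y := by
  rw [smul_smul, smul_smul, smul_add]
  congr 2 <;> field_simp

theorem Convex.inv_smul_add_mem {K : Set C} (hK : Convex ℝ≥0 K) {a b : ℝ≥0} (ha : a ≠ 0)
    (hb : b ≠ 0) {x y : C} (hx : a⁻¹ • x ∈ K) (hy : b⁻¹ • y ∈ K) :
    (a + b)⁻¹ • (x + y) ∈ K := by
  rw [inv_smul_add_eq ha hb]
  refine hK hx hy zero_le zero_le ?_
  rw [← add_div, div_self (by simp [ha])]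

/-! ### Open sets of a semitopological cone, and linearity of the gauge. -/

variable [TopologicalSpace C] [SemitopologicalCone C]

theorem IsOpen.isOpen_scott_smul_mem (hH : IsOpen H) (x : C) :
    IsOpen {r : Topology.WithScott ℝ≥0 | Topology.WithScott.ofScott r • x ∈ H} :=
  hH.preimage (SemitopologicalCone.continuous_smul_right x)

theorem IsOpen.smul_mem_of_le (hH : IsOpen H) {x : C} {r s : ℝ≥0} (h : r ≤ s)
    (hr : r • x ∈ H) : s • x ∈ H :=
  IsScott.isUpperSet_of_isOpen (D := univ) (hH.isOpen_scott_smul_mem x)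
    (show Topology.WithScott.toScott r ≤ Topology.WithScott.toScott s from h) hr

/-- A Scott-open set is inaccessible by directed suprema, and `r ≠ 0` is the supremum of the
nonempty directed set of scalars below it. -/
theorem IsOpen.exists_lt_smul_mem (hH : IsOpen H) {x : C} {r : ℝ≥0} (h0 : r ≠ 0)
    (hr : r • x ∈ H) : ∃ s < r, s • x ∈ H := by
  have h := (IsScott.isOpen_iff_isUpperSet_and_dirSupInaccOn (D := univ)).1
    (hH.isOpen_scott_smul_mem x)
  have hdir : DirectedOn (· ≤ ·) (Iio r) := fun a ha b hb =>
    ⟨max a b, mem_Iio.2 (max_lt ha hb), le_max_left a b, le_max_right a b⟩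
  obtain ⟨s, hs, hsH⟩ := h.2 (mem_univ (Iio r : Set ℝ≥0)) ⟨(0 : ℝ≥0), pos_iff_ne_zero.2 h0⟩
    hdir (isLUB_Iio (γ := ℝ≥0)) hr
  exact ⟨s, hs, hsH⟩

/-- The set of `s` with `x + s • y ∈ H` is Scott-open, hence an upper set; it contains `0`, so it
contains `1`. -/
theorem IsOpen.add_mem_left (hH : IsOpen H) {x : C} (hx : x ∈ H) (y : C) : x + y ∈ H := by
  have h := (hH.preimage (SemitopologicalCone.continuous_add_left x)).smul_mem_of_le
    (x := y) (r := 0) (s := 1) zero_le (by simpa using hx)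
  simpa using h

theorem IsOpen.eq_univ_of_zero_mem (hH : IsOpen H) (h0 : (0 : C) ∈ H) : H = univ :=
  eq_univ_of_forall fun y => by simpa using hH.add_mem_left h0 y

/-- Openness of `H` lets `r⁻¹` be shrunk slightly to `t`, which makes the inequality strict. -/
theorem lt_upperGauge_iff (hH : IsOpen H) (h0 : (0 : C) ∉ H) {r : ℝ≥0} (hr : r ≠ 0) {x : C} :
    (r : ℝ≥0∞) < upperGauge H x ↔ r⁻¹ • x ∈ H := by
  simp only [upperGauge, lt_iSup_iff, ENNReal.coe_lt_coe]
  constructor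
  · rintro ⟨s, hs, h⟩
    exact hH.smul_mem_of_le (inv_anti₀ (pos_iff_ne_zero.2 hr) h.le) hs
  · intro h
    obtain ⟨t, ht, htH⟩ := hH.exists_lt_smul_mem (inv_ne_zero hr) h
    have ht0 : t ≠ 0 := by rintro rfl; exact h0 (by simpa using htH)
    exact ⟨t⁻¹, by rwa [inv_inv], (lt_inv_comm₀ (pos_iff_ne_zero.2 ht0)
      (pos_iff_ne_zero.2 hr)).1 ht⟩

theorem one_lt_upperGauge_iff (hH : IsOpen H) (h0 : (0 : C) ∉ H) {x : C} :
    1 < upperGauge H x ↔ x ∈ H := by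
  simpa using lt_upperGauge_iff hH h0 one_ne_zero (x := x)

theorem lowerSemicontinuous_upperGauge (hH : IsOpen H) : LowerSemicontinuous (upperGauge H) := by
  rw [lowerSemicontinuous_iff_isOpen_preimage]
  intro y
  have : upperGauge H ⁻¹' Ioi y
      = ⋃ (r : ℝ≥0) (_ : y < r), (fun x : C => r⁻¹ • x) ⁻¹' H := by
    ext x
    simp [upperGauge, lt_iSup_iff, and_comm]
  rw [this]
  exact isOpen_biUnion fun r _ => hH.preimage (SemitopologicalCone.continuous_smul_left _)

theorem upperGauge_le_add_right (hH : IsOpen H) (x y : C) :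
    upperGauge H x ≤ upperGauge H (x + y) := by
  refine iSup₂_mono' fun r hr => ⟨r, ?_, le_rfl⟩
  rw [smul_add]
  exact hH.add_mem_left hr _

theorem add_le_upperGauge_add (hH : IsOpen H) (hc : Convex ℝ≥0 H) (h0 : (0 : C) ∉ H) (x y : C) :
    upperGauge H x + upperGauge H y ≤ upperGauge H (x + y) := by
  -- Adding suprema termwise needs both index sets to be nonempty. If one is empty, that gauge
  -- vanishes and monotonicity is enough.
  by_cases hx : ∃ r : ℝ≥0, r⁻¹ • x ∈ H
  · by_cases hy : ∃ r : ℝ≥0, r⁻¹ • y ∈ H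
    · refine ENNReal.biSup_add_biSup_le' hx hy fun a ha b hb => ?_
      have ne : ∀ {r : ℝ≥0} {z : C}, r⁻¹ • z ∈ H → r ≠ 0 := by
        rintro r z hr rfl
        exact h0 (by simpa using hr)
      rw [← ENNReal.coe_add]
      exact le_iSup₂ (f := fun (r : ℝ≥0) (_ : r⁻¹ • (x + y) ∈ H) => (r : ℝ≥0∞)) (a + b)
        (hc.inv_smul_add_mem (ne ha) (ne hb) ha hb)
    · have : upperGauge H y = 0 := by
        simp only [not_exists] at hy
        simp [upperGauge, hy]
      rw [this, add_zero]
      exact upperGauge_le_add_right hH x y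
  · have : upperGauge H x = 0 := by
      simp only [not_exists] at hx
      simp [upperGauge, hx]
    rw [this, zero_add, add_comm]
    exact upperGauge_le_add_right hH y x

/-- Scaling `x` and `y` down by slightly more than their gauges lands in the complement of `H`, and
so does the resulting convex combination. -/
theorem upperGauge_add_le (hH : IsOpen H) (hc : Convex ℝ≥0 Hᶜ) (h0 : (0 : C) ∉ H) (x y : C) :
    upperGauge H (x + y) ≤ upperGauge H x + upperGauge H y := by
  refine ENNReal.le_of_forall_pos_le_add fun ε hε hlt => ?_
  obtain ⟨hx, hy⟩ := ENNReal.add_lt_top.1 hlt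
  lift upperGauge H x to ℝ≥0 using hx.ne with p hp
  lift upperGauge H y to ℝ≥0 using hy.ne with q hq
  -- The slack `ε / 2` keeps the scalars `p + ε / 2` and `q + ε / 2` invertible even when a gauge is
  -- zero.
  have hε2 : ε / 2 ≠ 0 := by simpa using hε.ne'
  have key : ∀ {z : C} {s : ℝ≥0}, (s : ℝ≥0∞) = upperGauge H z → (s + ε / 2)⁻¹ • z ∈ Hᶜ := by
    intro z s hs hz
    rw [← lt_upperGauge_iff hH h0 (by simp [hε2]), ← hs, ENNReal.coe_lt_coe] at hz
    exact absurd hz (by simp)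
  have h := hc.inv_smul_add_mem (by simp [hε2]) (by simp [hε2]) (key hp) (key hq)
  have e : p + ε / 2 + (q + ε / 2) = p + q + ε := by
    rw [add_add_add_comm, add_halves]
  rw [e] at h
  rw [← ENNReal.coe_add, ← ENNReal.coe_add, ← not_lt, lt_upperGauge_iff hH h0 (by simp [hε.ne'])]
  exact h

theorem IsHalfSpace.exists_linear (hH : IsOpen H) (hc : IsHalfSpace H) (h0 : (0 : C) ∉ H) :
    ∃ Λ : C →ₗ[ℝ≥0] ℝ≥0∞, LowerSemicontinuous Λ ∧ H = Λ ⁻¹' Ioi 1 :=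
  ⟨{ toFun := upperGauge H
     map_add' := fun x y =>
       le_antisymm (upperGauge_add_le hH hc.2 h0 x y) (add_le_upperGauge_add hH hc.1 h0 x y)
     map_smul' := fun c x => upperGauge_smul h0 c x },
    lowerSemicontinuous_upperGauge hH, ext fun _ => (one_lt_upperGauge_iff hH h0).symm⟩

end Gauge

/-! ### Locally linear cones -/

/-- The sets `{x | 1 < Λ x}`, for `Λ` linear and lower semi-continuous. -/
def linearSubbase (C : Type u) [TopologicalSpace C] [AddCommMonoid C] [Module ℝ≥0 C] :
    Set (Set C) :=
  {s | ∃ Λ : C →ₗ[ℝ≥0] ℝ≥0∞, LowerSemicontinuous Λ ∧ s = Λ ⁻¹' Ioi 1}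

namespace IsLocallyLinear

variable {C : Type u} [t : TopologicalSpace C] [AddCommMonoid C] [Module ℝ≥0 C]
  [SemitopologicalCone C]

theorem eq_generateFrom (hlin : IsLocallyLinear C) : t = generateFrom (linearSubbase C) := by
  obtain ⟨S, hS, ht⟩ := hlin
  apply le_antisymm
  · rw [le_generateFrom_iff_subset_isOpen]
    rintro _ ⟨Λ, hΛ, rfl⟩
    exact hΛ.isOpen_preimage 1
  · conv_rhs => rw [ht]
    rw [le_generateFrom_iff_subset_isOpen]
    intro H hH
    by_cases h0 : (0 : C) ∈ H
    · rw [(hS H hH).1.eq_univ_of_zero_mem h0]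
      exact @isOpen_univ _ (generateFrom _)
    · exact isOpen_generateFrom_of_mem ((hS H hH).2.exists_linear (hS H hH).1 h0)

theorem continuous_of_isOpen {X : Type*} [TopologicalSpace X] (hlin : IsLocallyLinear C)
    {f : X → C} (hf : ∀ Λ : C →ₗ[ℝ≥0] ℝ≥0∞, LowerSemicontinuous Λ → IsOpen {x | 1 < Λ (f x)}) :
    Continuous f := by
  have h : @Continuous X C _ (generateFrom (linearSubbase C)) f :=
    continuous_generateFrom_iff.2 <| by
      rintro _ ⟨Λ, hΛ, rfl⟩
      exact hf Λ hΛ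
  rwa [← hlin.eq_generateFrom] at h

/-- Points on which all `Λ` agree lie in the same subbasic open sets, hence are inseparable, hence
equal by `T₀`. -/
theorem eq_of_forall_linear (hlin : IsLocallyLinear C) {x y : C}
    (h : ∀ Λ : C →ₗ[ℝ≥0] ℝ≥0∞, LowerSemicontinuous Λ → Λ x = Λ y) : x = y := by
  refine Inseparable.eq ?_
  have hb := isTopologicalBasis_of_subbasis hlin.eq_generateFrom
  rw [hb.inseparable_iff]
  rintro _ ⟨f, ⟨-, hf⟩, rfl⟩
  simp only [mem_sInter]
  refine forall₂_congr fun s hs => ?_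
  obtain ⟨Λ, hΛ, rfl⟩ := hf hs
  simp [h Λ hΛ]

theorem quasiSober (hlin : IsLocallyLinear C)
    (hbary : ∀ ν : ContValuation C, ∃ b : C, IsBarycentre b ν) : QuasiSober C where
  sober {Z} hZ hZc := by
    obtain ⟨b, hb⟩ := hbary (.ofIrreducible Z hZ)
    have hbase := isTopologicalBasis_of_subbasis hlin.eq_generateFrom
    -- This is where the barycentre property enters. It concerns subbasic sets only; finite
    -- intersections are handled by irreducibility below.
    have key : ∀ s ∈ linearSubbase C, b ∈ s ↔ (Z ∩ s).Nonempty := by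
      rintro _ ⟨Λ, hΛ, rfl⟩
      rw [mem_preimage, mem_Ioi, hb Λ hΛ, ContValuation.one_lt_integral_ofIrreducible_iff]
      rfl
    refine ⟨b, ?_⟩
    apply Subset.antisymm
    · rw [hZc.closure_subset_iff, singleton_subset_iff, ← hZc.closure_eq, hbase.mem_closure_iff]
      rintro _ ⟨f, ⟨hfin, hf⟩, rfl⟩ hbf
      rw [inter_comm]
      -- An irreducible set that meets each of finitely many open sets meets their intersection, so
      -- every basic neighbourhood of `b` meets `Z`.
      have := isIrreducible_iff_sInter.1 hZ hfin.toFinset (fun u hu => ?_) (fun u hu => ?_)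
      · simpa using this
      · exact hbase.isOpen ⟨{u}, ⟨finite_singleton u,
          singleton_subset_iff.2 (hf (hfin.mem_toFinset.1 hu))⟩, sInter_singleton u⟩
      · have hu := hfin.mem_toFinset.1 hu
        exact (key u (hf hu)).1 (hbf u hu)
    · intro z hz
      rw [hbase.mem_closure_iff]
      rintro _ ⟨f, ⟨-, hf⟩, rfl⟩ hzf
      exact ⟨b, fun u hu => (key u (hf hu)).2 ⟨z, hz, hzf u hu⟩, rfl⟩

theorem topologicalCone (hlin : IsLocallyLinear C) : TopologicalCone C where
  continuous_add := hlin.continuous_of_isOpen fun Λ hΛ => by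
    have h : LowerSemicontinuous fun p : C × C => Λ p.1 + Λ p.2 :=
      (hΛ.comp continuous_fst).add (hΛ.comp continuous_snd)
    simp only [map_add]
    exact h.isOpen_preimage 1
  continuous_smul := hlin.continuous_of_isOpen fun Λ hΛ => by
    rw [isOpen_iff_mem_nhds]
    rintro ⟨r, x⟩ h
    change 1 < Λ (Topology.WithScott.ofScott r • x) at h
    -- The scalar `r` is nonzero because `Λ 0 = 0`, so some `s < r` still satisfies `1 < Λ (s • x)`.
    -- The neighbourhood is then the product of `(s, ∞)` and `{y | 1 < Λ (s • y)}`.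
    obtain ⟨s, hs, hsx⟩ :=
      (hΛ.isOpen_preimage 1).exists_lt_smul_mem (x := x)
        (r := Topology.WithScott.ofScott r) (by rintro h0; rw [h0] at h; simp at h) h
    have h1 : IsOpen (Ioi s : Set (Topology.WithScott ℝ≥0)) := by
      rw [IsScott.isOpen_iff_isUpperSet_and_dirSupInaccOn (D := univ)]
      refine ⟨isUpperSet_Ioi (α := ℝ≥0) s, fun d _ _ _ a ha has => ?_⟩
      obtain ⟨c, hc, hsc⟩ := (lt_isLUB_iff (α := ℝ≥0) ha).1 has
      exact ⟨c, hc, hsc⟩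
    have h2 : IsOpen {y | s • y ∈ Λ ⁻¹' Ioi 1} :=
      (hΛ.isOpen_preimage 1).preimage (SemitopologicalCone.continuous_smul_left s)
    refine mem_of_superset ((h1.prod h2).mem_nhds ⟨hs, hsx⟩) ?_
    rintro ⟨c, y⟩ ⟨hc, hy⟩
    exact (hΛ.isOpen_preimage 1).smul_mem_of_le (le_of_lt hc) hy

theorem isStructureMap (hlin : IsLocallyLinear C) {β : ContValuation C → C}
    (hβ : ∀ ν, IsBarycentre (β ν) ν) : ContValuation.IsStructureMap β := by
  have hc : Continuous β := hlin.continuous_of_isOpen fun Λ hΛ => by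
    have h := (ContValuation.lowerSemicontinuous_integral hΛ).isOpen_preimage 1
    simp only [hβ _ Λ hΛ]
    exact h
  refine ⟨hc, fun x => ?_, fun ϖ => ?_⟩
  · refine hlin.eq_of_forall_linear fun Λ hΛ => ?_
    rw [hβ _ Λ hΛ, ContValuation.integral_dirac]
  · refine hlin.eq_of_forall_linear fun Λ hΛ => ?_
    -- Under `Λ`, one side becomes the iterated integral of `Λ` and the other the integral of `Λ ∘
    -- β` against `ϖ`; the integrands agree because `β μ` is a barycentre of `μ`.
    rw [hβ _ Λ hΛ, hβ _ Λ hΛ, ContValuation.integral_mult, ContValuation.integral_map]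
    exact ϖ.integral_congr _ _ (funext fun μ => (hβ μ Λ hΛ).symm)

end IsLocallyLinear

theorem mainTheorem4 (C : Type u) [TopologicalSpace C] [AddCommMonoid C] [Module ℝ≥0 C]
    [SemitopologicalCone C] (hlin : IsLocallyLinear C)
    (hbary : ∀ ν : ContValuation C, ∃ b : C, IsBarycentre b ν) :
    (∀ ν : ContValuation C, ∃! b : C, IsBarycentre b ν) ∧
    (∀ β : ContValuation C → C, (∀ ν, IsBarycentre (β ν) ν) →
      Continuous β ∧ ContValuation.IsStructureMap β) ∧
    (T0Space C ∧ QuasiSober C) ∧ TopologicalCone C := by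
  refine ⟨fun ν => ?_, fun β hβ => ?_, ⟨inferInstance, hlin.quasiSober hbary⟩,
    hlin.topologicalCone⟩
  · obtain ⟨b, hb⟩ := hbary ν
    refine ⟨b, hb, fun c hc => hlin.eq_of_forall_linear fun Λ hΛ => ?_⟩
    rw [hb Λ hΛ, hc Λ hΛ]
  · have h := hlin.isStructureMap hβ
    exact ⟨h.continuous, h⟩
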